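/- Corollary 4.4. All Banach spaces are real. For $\lambda\ge 1$, a Banach space $E$ is called $\lambda$-separably injective if every bounded linear operator $T:M\to E$ from a closed subspace $M$ of a separable Banach space $Z$ extends to a bounded linear operator $S:Z\to E$ with $\|S\|\le\lambda\|T\|$. For $\varepsilon\ge 0$, a map $f:X\to Y$ between Banach spaces is a standard $\varepsilon$-isometry if $f(0)=0$ and $\big|\,\|f(x)-f(y)\|-\|x-y\|\,\big|\le\varepsilon$ for all $x,y\in X$; let $L(f)=\overline{\operatorname{span}}\,f(X)\subseteq Y$. For $\alpha,\gamma>0$, the pair $(X,Y)$ is $(\alpha,\gamma)$-stable if for every $\varepsilon\ge 0$ and every standard $\varepsilon$-isometry $f:X\to Y$ there is a bounded linear operator $T:L(f)\to X$ with $\|T\|\le\alpha$ and $\|Tf(x)-x\|\le\gamma\varepsilon$ for all $x\in X$. Let $\lambda\ge 1$ and let $\{E_i\}_{i\in\Lambda}$ be a family of $\lambda$-separably injective Banach spaces. Let $\big(\sum_{i\in\Lambda}E_i\big)_{\ell_\infty}$ be the Banach space of all families $(x_i)_{i\in\Lambda}$ with $x_i\in E_i$ and $\sup_i\|x_i\|<\infty$,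 with the supremum norm. Then for every separable Banach space $Y$ the pair $\big(\big(\sum_{i\in\Lambda}E_i\big)_{\ell_\infty},Y\big)$ is $(3\lambda,12\lambda)$-stable. -/

import Mathlib

open scoped ENNReal

/-- A (real Banach) space `X` is `lam`-separably injective: every bounded linear operator `T` from
a closed subspace `M` of a separable Banach space `Z` into `X` extends to a bounded linear operator
on `Z` of norm at most `lam * ‖T‖`.

Every separable Banach space has cardinality at most the continuum, hence has a linearly isometric
copy in `Type`, so letting `Z` range over `Type` loses nothing:
see `IsSeparablyInjective.exists_extension`. -/
def IsSeparablyInjective (lam : ℝ) (X : Type*) [NormedAddCommGroup X] [NormedSpace ℝ X] : Prop :=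
  ∀ (Z : Type) [NormedAddCommGroup Z] [NormedSpace ℝ Z] [CompleteSpace Z]
    [TopologicalSpace.SeparableSpace Z] (M : Submodule ℝ Z), IsClosed (M : Set Z) →
    ∀ T : M →L[ℝ] X, ∃ S : Z →L[ℝ] X, (∀ m : M, S m = T m) ∧ ‖S‖ ≤ lam * ‖T‖

/-- The extension property holds for separable Banach spaces in an arbitrary universe. -/
theorem IsSeparablyInjective.exists_extension {lam : ℝ} {X : Type*} [NormedAddCommGroup X]
    [NormedSpace ℝ X] (h : IsSeparablyInjective lam X)
    {Z : Type*} [NormedAddCommGroup Z] [NormedSpace ℝ Z] [CompleteSpace Z]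
    [TopologicalSpace.SeparableSpace Z] (M : Submodule ℝ Z) (hM : IsClosed (M : Set Z))
    (T : M →L[ℝ] X) :
    ∃ S : Z →L[ℝ] X, (∀ m : M, S m = T m) ∧ ‖S‖ ≤ lam * ‖T‖ := by
  have : Small.{0} Z := by
    refine small_of_injective (β := ℕ → ℝ)
      (f := fun z n => dist z (TopologicalSpace.denseSeq Z n)) fun z w hzw => ?_
    have hd := TopologicalSpace.denseRange_denseSeq Z
    have : (fun u => dist z u) = fun u => dist w u :=
      hd.equalizer (by fun_prop) (by fun_prop) hzw
    have h0 := congrFun this w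
    simpa using h0
  let e : Shrink.{0} Z ≃ₗᵢ[ℝ] Z :=
    { (Shrink.continuousLinearEquiv ℝ Z).toLinearEquiv with norm_map' := fun _ => rfl }
  have : CompleteSpace (Shrink.{0} Z) := (completeSpace_congr (e := e.toEquiv) e.isometry.isUniformEmbedding).2 ‹_›
  have : TopologicalSpace.SeparableSpace (Shrink.{0} Z) :=
    e.symm.surjective.denseRange.separableSpace e.symm.continuous
  let M' : Submodule ℝ (Shrink.{0} Z) := M.comap e.toLinearEquiv.toLinearMap
  have hM' : IsClosed (M' : Set (Shrink.{0} Z)) := hM.preimage e.continuous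
  let r : M' →L[ℝ] M :=
    ((e.toContinuousLinearEquiv : Shrink.{0} Z →L[ℝ] Z).comp M'.subtypeL).codRestrict M
      fun x => x.2
  have hr : ‖r‖ ≤ 1 := by
    refine ContinuousLinearMap.opNorm_le_bound _ zero_le_one fun x => ?_
    rw [one_mul]
    exact (e.norm_map x.1).le
  obtain ⟨S, hS, hSn⟩ := h (Shrink.{0} Z) M' hM' (T.comp r)
  have hlam : ‖S‖ ≤ lam * ‖T‖ := by
    rcases le_or_gt 0 lam with hl | hl
    · refine hSn.trans (mul_le_mul_of_nonneg_left ?_ hl)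
      calc ‖T.comp r‖ ≤ ‖T‖ * ‖r‖ := T.opNorm_comp_le r
        _ ≤ ‖T‖ := mul_le_of_le_one_right T.opNorm_nonneg hr
    · have h1 : ‖T.comp r‖ = 0 := by
        nlinarith [norm_nonneg S, norm_nonneg (T.comp r)]
      have h2 : T = 0 := by
        ext m
        have h3 : r ⟨e.symm m, by simp [M']⟩ = m := Subtype.ext (e.apply_symm_apply m)
        have h4 := congrArg (fun A : M' →L[ℝ] X => A ⟨e.symm m, by simp [M']⟩)
          (norm_eq_zero.1 h1)
        simpa [h3] using h4
      rw [h1] at hSn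
      rw [h2, ContinuousLinearMap.opNorm_zero]
      exact hSn
  refine ⟨S.comp (e.symm.toContinuousLinearEquiv : Z →L[ℝ] Shrink.{0} Z), fun m => ?_, ?_⟩
  · have h3 : r ⟨e.symm m, by simp [M']⟩ = m := Subtype.ext (e.apply_symm_apply m)
    have := hS ⟨e.symm m, by simp [M']⟩
    simpa [h3] using this
  · refine le_trans (ContinuousLinearMap.opNorm_le_bound _ (norm_nonneg S) fun z => ?_) hlam
    exact (S.le_opNorm _).trans_eq (by rw [← e.symm.norm_map z]; rfl)

/-- `f : X → Y` is a standard `ε`-isometry: `|‖f x - f y‖ - ‖x - y‖| ≤ ε` for all `x, y`, and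
`f 0 = 0`. -/
structure IsStandardEpsIsometry {X Y : Type*} [NormedAddCommGroup X] [NormedAddCommGroup Y]
    (ε : ℝ) (f : X → Y) : Prop where
  abs_le : ∀ x y : X, |‖f x - f y‖ - ‖x - y‖| ≤ ε
  map_zero : f 0 = 0

/-- `L(f)`, the closed linear span of the range of `f`. -/
def closedSpanRange {X Y : Type*} [NormedAddCommGroup Y] [NormedSpace ℝ Y] (f : X → Y) :
    Submodule ℝ Y :=
  (Submodule.span ℝ (Set.range f)).topologicalClosure

theorem mem_closedSpanRange {X Y : Type*} [NormedAddCommGroup Y] [NormedSpace ℝ Y] (f : X → Y)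
    (x : X) : f x ∈ closedSpanRange f :=
  Submodule.le_topologicalClosure _ (Submodule.subset_span (Set.mem_range_self x))

/-- The `ε`-isometry `f` is `(α, γ)`-stable: there is a bounded linear operator `T : L(f) → X` with
`‖T‖ ≤ α` and `‖T (f x) - x‖ ≤ γ ε` for all `x`. -/
def IsStableEpsIsometry {X Y : Type*} [NormedAddCommGroup X] [NormedSpace ℝ X]
    [NormedAddCommGroup Y] [NormedSpace ℝ Y] (α γ ε : ℝ) (f : X → Y) : Prop :=
  ∃ T : closedSpanRange f →L[ℝ] X,
    ‖T‖ ≤ α ∧ ∀ x : X, ‖T ⟨f x, mem_closedSpanRange f x⟩ - x‖ ≤ γ * ε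

/-- The pair `(X, Y)` is `(α, γ)`-stable: `α, γ > 0` and, for every `ε ≥ 0`, every standard
`ε`-isometry `f : X → Y` is `(α, γ)`-stable. -/
def IsStablePair (α γ : ℝ) (X Y : Type*) [NormedAddCommGroup X] [NormedSpace ℝ X]
    [NormedAddCommGroup Y] [NormedSpace ℝ Y] : Prop :=
  0 < α ∧ 0 < γ ∧ ∀ ε : ℝ, 0 ≤ ε → ∀ f : X → Y,
    IsStandardEpsIsometry ε f → IsStableEpsIsometry α γ ε f

/-! Write `X` for the `ℓ∞`-sum; extending operators coordinatewise makes it `lam`-separably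
injective. An `ε`-isometry `f` into a separable `Y` forces `X` to be separable, so by Mazur's
theorem the norm of `X` has gradients `g u` at a dense set of points `u`, and `J x = (g u x)_u`
embeds `X` isometrically in an `ℓ∞` space `W`. Each `g u` is shadowed within `3ε` along `f` by a
functional `φ u` on `Y` of norm at most one; with `A y = (φ u y)_u` this says `‖A (f x) - J x‖ ≤
3ε`. The closure of `J(X) + A(Y)` is separable, so the inverse of `J` extends to it as some `P` with
`‖P‖ ≤ lam`, and `P ∘ A` restricted to `L(f)` is the required operator. The constants obtained are
`lam` and `3 * lam`. -/

open Filter Topology in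
/-- A Banach space admitting an `ε`-isometry into a separable space is separable. -/
theorem IsStandardEpsIsometry.separableSpace {X Y : Type*} [NormedAddCommGroup X] [NormedSpace ℝ X]
    [NormedAddCommGroup Y] [TopologicalSpace.SeparableSpace Y] {ε : ℝ} {f : X → Y}
    (hf : IsStandardEpsIsometry ε f) : TopologicalSpace.SeparableSpace X := by
  have : SecondCountableTopology Y := UniformSpace.secondCountable_of_separable Y
  have hne : Nonempty (Set.range f) := ⟨⟨f 0, 0, rfl⟩⟩
  choose s hs using fun n => (TopologicalSpace.denseSeq (Set.range f) n).2
  have hnet : ∀ x, ∃ k, ‖x - s k‖ ≤ 1 + ε := by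
    intro x
    obtain ⟨k, hk⟩ := (TopologicalSpace.denseRange_denseSeq (Set.range f)).exists_dist_lt
      ⟨f x, x, rfl⟩ one_pos
    refine ⟨k, ?_⟩
    rw [Subtype.dist_eq, ← hs k, dist_eq_norm] at hk
    have := (_root_.abs_le.1 (hf.abs_le x (s k))).1
    linarith
  -- The points `s k` form a `(1 + ε)`-net; dilating by `n + 1` and shrinking back divides the error
  -- by `n + 1`.
  refine ⟨⟨Set.range fun p : ℕ × ℕ => ((p.1 : ℝ) + 1)⁻¹ • s p.2, Set.countable_range _, ?_⟩⟩
  refine Metric.dense_iff.2 fun x r hr => ?_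
  obtain ⟨n, hn⟩ := exists_nat_gt ((1 + ε) / r)
  obtain ⟨k, hk⟩ := hnet (((n : ℝ) + 1) • x)
  have hn0 : (0 : ℝ) < n + 1 := by positivity
  refine ⟨_, ?_, ⟨(n, k), rfl⟩⟩
  have h1 : ((n : ℝ) + 1)⁻¹ • s k - x = -(((n : ℝ) + 1)⁻¹ • (((n : ℝ) + 1) • x - s k)) := by
    rw [smul_sub, inv_smul_smul₀ hn0.ne']; abel
  rw [Metric.mem_ball, dist_eq_norm]
  show ‖((n : ℝ) + 1)⁻¹ • s k - x‖ < r
  rw [h1, norm_neg, norm_smul, Real.norm_of_nonneg (by positivity), inv_mul_lt_iff₀ hn0]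
  rw [div_lt_iff₀ hr] at hn
  linarith

/-! ### Gateaux differentiability of the norm. -/

/-- `g` is the Gateaux derivative of the norm at `u`, in the form of a limit at infinity along the
ray spanned by `u`. -/
def IsNormGradient {X : Type*} [NormedAddCommGroup X] [NormedSpace ℝ X] (u : X)
    (g : X →L[ℝ] ℝ) : Prop :=
  ∀ x, Filter.Tendsto (fun n : ℕ => ‖(n : ℝ) • u + x‖ - n * ‖u‖) Filter.atTop (nhds (g x))

section NormGradient

open Filter Topology

variable {X : Type*} [NormedAddCommGroup X] [NormedSpace ℝ X]

theorem antitone_norm_ray (u x : X) :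
    Antitone fun n : ℕ => ‖(n : ℝ) • u + x‖ - n * ‖u‖ := by
  refine antitone_nat_of_succ_le fun n => ?_
  have h : ((n + 1 : ℕ) : ℝ) • u + x = ((n : ℝ) • u + x) + u := by
    push_cast; rw [add_smul, one_smul]; abel
  rw [h]
  have := norm_add_le ((n : ℝ) • u + x) u
  push_cast
  linarith

theorem neg_norm_le_norm_ray (u x : X) (n : ℕ) : -‖x‖ ≤ ‖(n : ℝ) • u + x‖ - n * ‖u‖ := by
  have h := norm_sub_le ((n : ℝ) • u + x) x
  rw [add_sub_cancel_right, norm_smul, Real.norm_natCast] at h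
  linarith

/-- The norm has a gradient at `u` if its second differences along the ray of `u` vanish in the
limit. -/
theorem exists_isNormGradient {u : X}
    (hu : ∀ x, ∀ δ > 0, ∃ n : ℕ, ‖(n : ℝ) • u + x‖ + ‖(n : ℝ) • u - x‖ - 2 * n * ‖u‖ < δ) :
    ∃ g, IsNormGradient u g := by
  have hlim : ∀ x, ∃ p, Tendsto (fun n : ℕ => ‖(n : ℝ) • u + x‖ - n * ‖u‖) atTop (𝓝 p) :=
    fun x => ⟨_, tendsto_atTop_ciInf (antitone_norm_ray u x)
      ⟨-‖x‖, by rintro _ ⟨n, rfl⟩; exact neg_norm_le_norm_ray u x n⟩⟩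
  choose p hp using hlim
  have hsub : ∀ x y, p (x + y) ≤ p x + p y := by
    intro x y
    -- Along even indices, `2n • u + (x + y)` splits evenly into `n • u + x` and `n • u + y`.
    have h2 : Tendsto (fun n : ℕ => 2 * n) atTop atTop :=
      tendsto_id.const_mul_atTop' two_pos
    refine le_of_tendsto_of_tendsto' ((hp (x + y)).comp h2) ((hp x).add (hp y)) fun n => ?_
    have h : ((2 * n : ℕ) : ℝ) • u + (x + y) = ((n : ℝ) • u + x) + ((n : ℝ) • u + y) := by
      push_cast; rw [two_mul, add_smul]; abel
    have := norm_add_le ((n : ℝ) • u + x) ((n : ℝ) • u + y)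
    simp only [Function.comp_apply, h]
    push_cast
    linarith
  have hneg : ∀ x, p x + p (-x) ≤ 0 := by
    intro x
    refine le_of_forall_pos_le_add fun δ hδ => ?_
    obtain ⟨n, hn⟩ := hu x δ hδ
    have h1 := (antitone_norm_ray u x).le_of_tendsto (hp x) n
    have h2 := (antitone_norm_ray u (-x)).le_of_tendsto (hp (-x)) n
    simp only [← sub_eq_add_neg] at h2
    linarith
  have hle : ∀ x, p x ≤ ‖x‖ := by
    intro x
    have := (antitone_norm_ray u x).le_of_tendsto (hp x) 0
    simpa using this
  have hadd : ∀ x y, p (x + y) = p x + p y := by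
    intro x y
    refine le_antisymm (hsub x y) ?_
    have h1 := hsub (x + y) (-y)
    have h2 := hneg y
    rw [add_neg_cancel_right] at h1
    linarith
  let P : X →+ ℝ := AddMonoidHom.mk' p hadd
  have habs : ∀ x, ‖P x‖ ≤ 1 * ‖x‖ := by
    intro x
    rw [Real.norm_eq_abs, one_mul, abs_le]
    have h1 := hle (-x)
    have h2 : P (-x) = - P x := map_neg P x
    rw [norm_neg] at h1
    exact ⟨by linarith [show p (-x) = - P x from h2], hle x⟩
  exact ⟨P.toRealLinearMap (AddMonoidHomClass.continuous_of_bound P 1 habs), hp⟩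

theorem IsNormGradient.le_norm {u : X} {g : X →L[ℝ] ℝ} (hg : IsNormGradient u g) (x : X) :
    g x ≤ ‖x‖ := by
  simpa using (antitone_norm_ray u x).le_of_tendsto (hg x) 0

theorem IsNormGradient.abs_le_norm {u : X} {g : X →L[ℝ] ℝ} (hg : IsNormGradient u g) (x : X) :
    |g x| ≤ ‖x‖ := by
  have h := hg.le_norm (-x)
  rw [map_neg, norm_neg] at h
  exact _root_.abs_le.2 ⟨by linarith, hg.le_norm x⟩

theorem IsNormGradient.apply_self {u : X} {g : X →L[ℝ] ℝ} (hg : IsNormGradient u g) :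
    g u = ‖u‖ := by
  refine tendsto_nhds_unique (hg u) (tendsto_const_nhds.congr fun n => ?_)
  have h : (n : ℝ) • u + u = ((n : ℝ) + 1) • u := by rw [add_smul, one_smul]
  rw [h, norm_smul, Real.norm_of_nonneg (by positivity)]
  ring

/-- Along a line with direction `x`, the second differences of the norm vanish to first order at a
dense set of points. -/
theorem dense_setOf_norm_second_difference_lt (x : X) {δ : ℝ} (hδ : 0 < δ) :
    Dense {u : X | ∃ n : ℕ, ‖(n : ℝ) • u + x‖ + ‖(n : ℝ) • u - x‖ - 2 * n * ‖u‖ < δ} := by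
  intro v
  let h : ℝ → ℝ := fun t => ‖v + t • x‖
  have hL : LipschitzWith ‖x‖₊ h := by
    refine LipschitzWith.of_dist_le_mul fun s t => ?_
    rw [Real.dist_eq, Real.dist_eq]
    refine (abs_norm_sub_norm_le _ _).trans_eq ?_
    rw [add_sub_add_left_eq_sub, ← sub_smul, norm_smul, coe_nnnorm, mul_comm, Real.norm_eq_abs]
  -- Rademacher in one variable: a Lipschitz function is differentiable almost everywhere.
  have hD : Dense {t | DifferentiableAt ℝ h t} :=
    MeasureTheory.Measure.dense_of_ae (μ := MeasureTheory.volume) hL.ae_differentiableAt_real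
  have hc : ContinuousAt (fun t : ℝ => v + t • x) 0 := by fun_prop
  rw [mem_closure_iff_nhds]
  intro U hU
  have hU' : (fun t : ℝ => v + t • x) ⁻¹' U ∈ 𝓝 (0 : ℝ) := hc (by simpa using hU)
  obtain ⟨t, htU, ht⟩ := mem_closure_iff_nhds.1 (hD 0) _ hU'
  refine ⟨v + t • x, htU, ?_⟩
  have hs := hasDerivAt_iff_tendsto_slope_zero.1 (DifferentiableAt.hasDerivAt ht)
  have hi : Tendsto (fun n : ℕ => ((n : ℝ) + 1)⁻¹) atTop (𝓝[≠] 0) :=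
    tendsto_nhdsWithin_iff.2 ⟨by simpa using tendsto_one_div_add_atTop_nhds_zero_nat (𝕜 := ℝ),
      Eventually.of_forall fun n => by
        simp only [Set.mem_compl_iff, Set.mem_singleton_iff]; positivity⟩
  have hi' : Tendsto (fun n : ℕ => -((n : ℝ) + 1)⁻¹) atTop (𝓝[≠] 0) :=
    tendsto_nhdsWithin_iff.2
      ⟨by simpa using (tendsto_one_div_add_atTop_nhds_zero_nat (𝕜 := ℝ)).neg,
      Eventually.of_forall fun n => by
        simp only [Set.mem_compl_iff, Set.mem_singleton_iff, neg_eq_zero]; positivity⟩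
  -- The slopes of `h` at steps `±1/(n + 1)` share a limit, and their difference is the second
  -- difference of the norm along the ray.
  have hlim := (hs.comp hi).sub (hs.comp hi')
  rw [sub_self] at hlim
  obtain ⟨n, hn⟩ := (hlim.eventually_lt_const hδ).exists
  refine ⟨n + 1, ?_⟩
  have hn0 : (0 : ℝ) < n + 1 := by positivity
  have e1 : ((n : ℝ) + 1) • (v + t • x) + x
      = ((n : ℝ) + 1) • (v + (t + ((n : ℝ) + 1)⁻¹) • x) := by
    simp only [smul_add, add_smul, smul_inv_smul₀ hn0.ne', one_smul]; abel
  have e2 : ((n : ℝ) + 1) • (v + t • x) - x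
      = ((n : ℝ) + 1) • (v + (t + -((n : ℝ) + 1)⁻¹) • x) := by
    simp only [smul_add, add_smul, neg_smul, smul_neg, smul_inv_smul₀ hn0.ne', one_smul]; abel
  push_cast
  rw [e1, e2, norm_smul, norm_smul, Real.norm_of_nonneg hn0.le]
  refine lt_of_eq_of_lt ?_ hn
  simp only [Function.comp_apply, h, smul_eq_mul, inv_inv, inv_neg]
  ring

/-- **Mazur's theorem**: the norm of a separable Banach space is Gateaux differentiable at a dense
set of points. -/
theorem dense_setOf_exists_isNormGradient [CompleteSpace X] [TopologicalSpace.SeparableSpace X] :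
    Dense {u : X | ∃ g, IsNormGradient u g} := by
  -- Baire category: countably many directions and tolerances suffice, since second differences are
  -- Lipschitz in the direction.
  let O : ℕ × ℕ → Set X := fun k =>
    {u | ∃ n : ℕ, ‖(n : ℝ) • u + TopologicalSpace.denseSeq X k.1‖
      + ‖(n : ℝ) • u - TopologicalSpace.denseSeq X k.1‖ - 2 * n * ‖u‖ < 1 / ((k.2 : ℝ) + 1)}
  have hO : ∀ k, IsOpen (O k) := by
    intro k
    simp only [O, Set.ofPred_exists]
    exact isOpen_iUnion fun n => isOpen_lt (by fun_prop) continuous_const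
  have hd : ∀ k, Dense (O k) := fun k =>
    dense_setOf_norm_second_difference_lt _ (by positivity)
  refine (dense_iInter_of_isOpen hO hd).mono fun u hu => exists_isNormGradient fun x δ hδ => ?_
  obtain ⟨m, hm⟩ := exists_nat_one_div_lt (half_pos hδ)
  obtain ⟨k, hk⟩ := (TopologicalSpace.denseRange_denseSeq X).exists_dist_lt x
    (show 0 < δ / 4 by positivity)
  obtain ⟨n, hn⟩ := Set.mem_iInter.1 hu (k, m)
  refine ⟨n, ?_⟩
  simp only at hn
  set y := TopologicalSpace.denseSeq X k
  rw [dist_eq_norm] at hk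
  have h1 := norm_add_le ((n : ℝ) • u + y) (x - y)
  have h2 := norm_sub_le ((n : ℝ) • u - y) (x - y)
  rw [show (n : ℝ) • u + y + (x - y) = (n : ℝ) • u + x by abel] at h1
  rw [show (n : ℝ) • u - y - (x - y) = (n : ℝ) • u - x by abel] at h2
  linarith

/-- Gradients of the norm at a dense set of points form a norming family. -/
theorem norm_le_of_dense_isNormGradient {S : Set X} (hS : Dense S) {g : S → X →L[ℝ] ℝ}
    (hg : ∀ u : S, IsNormGradient (u : X) (g u)) {x : X} {C : ℝ} (hC : ∀ u, |g u x| ≤ C) :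
    ‖x‖ ≤ C := by
  refine le_of_forall_pos_le_add fun δ hδ => ?_
  obtain ⟨u, hu, hxu⟩ := hS.exists_dist_lt x (half_pos hδ)
  have h1 := (hg ⟨u, hu⟩).apply_self
  have h2 := (hg ⟨u, hu⟩).le_norm (u - x)
  have h3 := (le_abs_self _).trans (hC ⟨u, hu⟩)
  rw [dist_eq_norm] at hxu
  rw [map_sub, norm_sub_rev] at h2
  have h4 := norm_sub_norm_le x u
  simp only at h1
  linarith

/-! ### Shadowing gradients along an `ε`-isometry. -/

variable {Y : Type*} [NormedAddCommGroup Y] [NormedSpace ℝ Y]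

/-- Weak stability: the gradient of the norm at a smooth point is shadowed along an `ε`-isometry by
a functional of norm at most one. -/
theorem IsStandardEpsIsometry.exists_functional {ε : ℝ} {f : X → Y}
    (hf : IsStandardEpsIsometry ε f) {u : X} {g : X →L[ℝ] ℝ} (hg : IsNormGradient u g) :
    ∃ φ : Y →L[ℝ] ℝ, ‖φ‖ ≤ 1 ∧ ∀ x, |φ (f x) - g x| ≤ 3 * ε := by
  -- Each `ψ n` norms the image of the segment from `-n • u` to `n • u`. Comparing `f x` with the
  -- ends loses `ε` in each of three estimates, hence `3ε`.
  choose ψ hψn hψ using fun n : ℕ =>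
    exists_dual_vector'' ℝ (f ((n : ℝ) • u) - f (-((n : ℝ) • u)))
  have hle : ∀ n y, ψ n y ≤ ‖y‖ := fun n y =>
    (le_abs_self _).trans (by simpa using (ψ n).le_of_opNorm_le (hψn n) y)
  have hupper : ∀ n x y, ψ n (f x) - ψ n (f y) ≤ ‖x - y‖ + ε := by
    intro n x y
    rw [← map_sub]
    have := (_root_.abs_le.1 (hf.abs_le x y)).2
    linarith [hle n (f x - f y)]
  have hself : ∀ n : ℕ, 2 * (n * ‖u‖) - ε ≤ ψ n (f ((n : ℝ) • u)) - ψ n (f (-((n : ℝ) • u))) := by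
    intro n
    have h1 := (_root_.abs_le.1 (hf.abs_le ((n : ℝ) • u) (-((n : ℝ) • u)))).1
    rw [sub_neg_eq_add, ← two_smul ℝ ((n : ℝ) • u), norm_smul, norm_smul, Real.norm_two,
      Real.norm_natCast] at h1
    rw [← map_sub, hψ n]
    simp only [RCLike.ofReal_real_eq_id, id_eq]
    linarith
  have hzero : ∀ n, ψ n (f 0) = 0 := fun n => by rw [hf.map_zero, _root_.map_zero]
  have hnorm : ∀ n : ℕ, ‖(n : ℝ) • u‖ = n * ‖u‖ := fun n => by
    rw [norm_smul, Real.norm_natCast]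
  have hU : ∀ (n : ℕ) x, ψ n (f x) ≤ (‖(n : ℝ) • u + x‖ - n * ‖u‖) + 3 * ε := by
    intro n x
    have h1 := hupper n x (-((n : ℝ) • u))
    have h2 := hupper n ((n : ℝ) • u) 0
    rw [sub_neg_eq_add, add_comm x] at h1
    rw [sub_zero, hzero, hnorm] at h2
    linarith [hself n]
  have hLo : ∀ (n : ℕ) x, -(‖(n : ℝ) • u + -x‖ - n * ‖u‖) - 3 * ε ≤ ψ n (f x) := by
    intro n x
    have h1 := hupper n ((n : ℝ) • u) x
    have h2 := hupper n 0 (-((n : ℝ) • u))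
    rw [sub_eq_add_neg _ x] at h1
    rw [sub_neg_eq_add, zero_add, hzero, hnorm] at h2
    linarith [hself n]
  -- Banach–Alaoglu: an ultrafilter gives a weak-star limit of the `ψ n` without extracting a
  -- subsequence.
  let F : Ultrafilter ℕ := Ultrafilter.of atTop
  have hF : (F : Filter ℕ) ≤ atTop := Ultrafilter.of_le atTop
  have hcomp := WeakDual.isCompact_closedBall (𝕜 := ℝ) (E := Y) 0 1
  let ψ' : ℕ → WeakDual ℝ Y := fun n => StrongDual.toWeakDual (ψ n)
  obtain ⟨φ, hφ, hφlim⟩ := hcomp.ultrafilter_le_nhds (F.map ψ') (by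
    rw [le_principal_iff]
    refine mem_map.2 (Eventually.of_forall fun n => ?_)
    simpa [ψ'] using hψn n)
  have hT : ∀ y, Tendsto (fun n => ψ n y) F (𝓝 (φ y)) := fun y =>
    ((WeakDual.eval_continuous y).tendsto φ).comp hφlim
  refine ⟨WeakDual.toStrongDual φ, by simpa using hφ, fun x => ?_⟩
  have hx := (hg x).mono_left hF
  have hx' := (hg (-x)).mono_left hF
  have h1 := le_of_tendsto_of_tendsto' (hT (f x)) (hx.add_const (3 * ε)) fun n => hU n x
  have h2 := le_of_tendsto_of_tendsto' (hx'.neg.sub_const (3 * ε)) (hT (f x)) fun n => hLo n x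
  rw [map_neg, neg_neg] at h2
  exact _root_.abs_le.2 ⟨by change _ ≤ φ (f x) - g x; linarith, by change φ (f x) - g x ≤ _; linarith⟩

end NormGradient

/-! ### Operators into `ℓ∞`-sums and separable injectivity. -/

/-- A uniformly bounded family of operators defines an operator into the `ℓ∞`-sum. -/
theorem exists_clm_lp_infty {Λ Z : Type*} {E : Λ → Type*} [∀ i, NormedAddCommGroup (E i)]
    [∀ i, NormedSpace ℝ (E i)] [NormedAddCommGroup Z] [NormedSpace ℝ Z]
    (S : ∀ i, Z →L[ℝ] E i) {C : ℝ} (hC : 0 ≤ C) (hS : ∀ i, ‖S i‖ ≤ C) :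
    ∃ T : Z →L[ℝ] lp E ∞, (∀ z i, T z i = S i z) ∧ ‖T‖ ≤ C := by
  have hb : ∀ z i, ‖S i z‖ ≤ C * ‖z‖ := fun z i => (S i).le_of_opNorm_le (hS i) z
  let L : Z →ₗ[ℝ] lp E ∞ :=
    { toFun := fun z => ⟨fun i => S i z, memℓp_infty ⟨C * ‖z‖, by rintro _ ⟨i, rfl⟩; exact hb z i⟩⟩
      map_add' := fun z w => by ext i; exact map_add (S i) z w
      map_smul' := fun c z => by ext i; exact map_smul (S i) c z }
  exact ⟨L.mkContinuous C fun z => lp.norm_le_of_forall_le (by positivity) (hb z), fun _ _ => rfl,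
    L.mkContinuous_norm_le hC _⟩

/-- The `ℓ∞`-sum of `lam`-separably injective spaces is `lam`-separably injective. -/
theorem IsSeparablyInjective.lp_infty {Λ : Type*} {E : Λ → Type*} [∀ i, NormedAddCommGroup (E i)]
    [∀ i, NormedSpace ℝ (E i)] {lam : ℝ} (hlam : 0 ≤ lam)
    (hE : ∀ i, IsSeparablyInjective lam (E i)) : IsSeparablyInjective lam (lp E ∞) := by
  intro Z _ _ _ _ M hM T
  let ev : ∀ i, lp E ∞ →L[ℝ] E i := fun i =>
    LinearMap.mkContinuous
      { toFun := fun x => x i, map_add' := fun _ _ => rfl, map_smul' := fun _ _ => rfl } 1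
      fun x => by rw [one_mul]; exact lp.norm_apply_le_norm ENNReal.top_ne_zero x i
  have hev : ∀ i, ‖ev i‖ ≤ 1 := fun i => LinearMap.mkContinuous_norm_le _ zero_le_one _
  choose S hS hSn using fun i => hE i Z M hM ((ev i).comp T)
  have hC : ∀ i, ‖S i‖ ≤ lam * ‖T‖ := fun i =>
    (hSn i).trans (mul_le_mul_of_nonneg_left (((ev i).opNorm_comp_le T).trans
      (mul_le_of_le_one_left T.opNorm_nonneg (hev i))) hlam)
  obtain ⟨R, hR, hRn⟩ := exists_clm_lp_infty S (by positivity) hC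
  refine ⟨R, fun m => ?_, hRn⟩
  ext i
  rw [hR, hS]
  rfl

/-- A separably injective Banach space `X` that embeds isometrically in a Banach space `W` is the
range of an operator of norm at most `lam`, defined on the closure of `J(X) + A(Y)`, for every
operator `A` from a separable space `Y`. -/
theorem IsSeparablyInjective.exists_retraction {X Y W : Type*} [NormedAddCommGroup X]
    [NormedSpace ℝ X] [CompleteSpace X] [TopologicalSpace.SeparableSpace X]
    [NormedAddCommGroup Y] [NormedSpace ℝ Y] [TopologicalSpace.SeparableSpace Y]
    [NormedAddCommGroup W] [NormedSpace ℝ W] [CompleteSpace W] {lam : ℝ} (hlam : 0 ≤ lam)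
    (hX : IsSeparablyInjective lam X) (J : X →ₗᵢ[ℝ] W) (A : Y →L[ℝ] W) (hA : ‖A‖ ≤ 1) :
    ∃ B : Y →L[ℝ] X, ‖B‖ ≤ lam ∧ ∀ y x, ‖B y - x‖ ≤ lam * ‖A y - J x‖ := by
  let D : X × Y →L[ℝ] W := J.toContinuousLinearMap.coprod A
  let V : Submodule ℝ W := (LinearMap.range D.toLinearMap).topologicalClosure
  have hsep : TopologicalSpace.IsSeparable (V : Set W) := by
    rw [Submodule.topologicalClosure_coe]
    exact (TopologicalSpace.isSeparable_range D.continuous).closure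
  have : TopologicalSpace.SeparableSpace V := hsep.separableSpace
  have : CompleteSpace V :=
    (Submodule.isClosed_topologicalClosure _).completeSpace_coe
  have hD : ∀ p, D p ∈ V := fun p =>
    Submodule.le_topologicalClosure _ (LinearMap.mem_range_self _ p)
  have hJV : ∀ x, J x ∈ V := fun x => by simpa [D] using hD (x, 0)
  have hAV : ∀ y, A y ∈ V := fun y => by simpa [D] using hD (0, y)
  let J' : X →ₗᵢ[ℝ] V :=
    { J.toLinearMap.codRestrict V hJV with norm_map' := fun x => J.norm_map x }
  let A' : Y →L[ℝ] V := A.codRestrict V hAV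
  have hA' : ‖A'‖ ≤ 1 := A'.opNorm_le_bound zero_le_one fun y => A.le_of_opNorm_le hA y
  let e := J'.equivRange
  let R : LinearMap.range J'.toLinearMap →L[ℝ] X :=
    e.symm.toLinearIsometry.toContinuousLinearMap
  have hR : ‖R‖ ≤ 1 := e.symm.toLinearIsometry.norm_toContinuousLinearMap_le
  -- The isometric image of the complete space `X` is closed, so the inverse of `J'` can be extended
  -- to `V`.
  have hcl : IsClosed (LinearMap.range J'.toLinearMap : Set V) := by
    rw [LinearMap.coe_range]
    exact J'.isometry.isClosedEmbedding.isClosed_range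
  obtain ⟨P, hP, hPn⟩ := hX.exists_extension (LinearMap.range J'.toLinearMap) hcl R
  have hPn' : ‖P‖ ≤ lam := hPn.trans (mul_le_of_le_one_right hlam hR)
  have hPJ : ∀ x, P (J' x) = x := fun x =>
    (hP ⟨J' x, x, rfl⟩).trans (e.symm_apply_apply x)
  refine ⟨P.comp A', (P.opNorm_comp_le A').trans ?_, fun y x => ?_⟩
  · exact (mul_le_of_le_one_right P.opNorm_nonneg hA').trans hPn'
  · have h := P.le_of_opNorm_le hPn' (A' y - J' x)
    rw [map_sub, hPJ] at h
    exact h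

/-- An `ε`-isometry from a separably injective space to a separable space is
`(lam, 3 * lam)`-stable. -/
theorem IsSeparablyInjective.isStableEpsIsometry {X Y : Type*} [NormedAddCommGroup X]
    [NormedSpace ℝ X] [CompleteSpace X] [NormedAddCommGroup Y] [NormedSpace ℝ Y]
    [TopologicalSpace.SeparableSpace Y] {lam ε : ℝ} (hlam : 0 ≤ lam) (hε : 0 ≤ ε)
    (hX : IsSeparablyInjective lam X) {f : X → Y} (hf : IsStandardEpsIsometry ε f) :
    IsStableEpsIsometry lam (3 * lam) ε f := by
  have := hf.separableSpace
  let G : Set X := {u : X | ∃ g, IsNormGradient u g}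
  have hG : Dense G := dense_setOf_exists_isNormGradient
  choose g hg using fun u : G => u.2
  choose φ hφn hφ using fun u : G => hf.exists_functional (hg u)
  obtain ⟨A, hA, hAn⟩ := exists_clm_lp_infty φ zero_le_one hφn
  obtain ⟨J, hJ, hJn⟩ := exists_clm_lp_infty g zero_le_one fun u =>
    (g u).opNorm_le_bound zero_le_one fun x => by simpa using (hg u).abs_le_norm x
  have hJx : ∀ x, ‖J x‖ = ‖x‖ := fun x =>
    le_antisymm (by simpa using J.le_of_opNorm_le hJn x)
      (norm_le_of_dense_isNormGradient hG hg fun u => by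
        rw [← hJ]; exact lp.norm_apply_le_norm ENNReal.top_ne_zero (J x) u)
  let J' : X →ₗᵢ[ℝ] lp (fun _ : G => ℝ) ∞ := ⟨J.toLinearMap, hJx⟩
  obtain ⟨B, hBn, hB⟩ := hX.exists_retraction hlam J' A hAn
  refine ⟨B.comp (closedSpanRange f).subtypeL, ?_, fun x => ?_⟩
  · refine ContinuousLinearMap.opNorm_le_bound _ hlam fun y => ?_
    exact B.le_of_opNorm_le hBn y
  · refine (hB (f x) x).trans ?_
    rw [mul_comm 3 lam, mul_assoc]
    refine mul_le_mul_of_nonneg_left (lp.norm_le_of_forall_le (by positivity) fun u => ?_) hlam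
    change ‖A (f x) u - J x u‖ ≤ _
    rw [hA, hJ]
    exact hφ u x

/-- `lp E ∞` is the `ℓ∞`-sum of the family `E`: bounded families with the supremum norm. -/
theorem corollary4p4 {Λ : Type*} (E : Λ → Type*) [∀ i, NormedAddCommGroup (E i)]
    [∀ i, NormedSpace ℝ (E i)] [∀ i, CompleteSpace (E i)] (lam : ℝ) (hlam : 1 ≤ lam)
    (hE : ∀ i, IsSeparablyInjective lam (E i))
    (Y : Type*) [NormedAddCommGroup Y] [NormedSpace ℝ Y] [CompleteSpace Y]
    [TopologicalSpace.SeparableSpace Y] :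
    IsStablePair (3 * lam) (12 * lam) (lp E ∞) Y := by
  have hlam0 : 0 ≤ lam := zero_le_one.trans hlam
  refine ⟨by positivity, by positivity, fun ε hε f hf => ?_⟩
  obtain ⟨T, hT, hTf⟩ :=
    (IsSeparablyInjective.lp_infty hlam0 hE).isStableEpsIsometry hlam0 hε hf
  refine ⟨T, by linarith, fun x => (hTf x).trans ?_⟩
  exact mul_le_mul_of_nonneg_right (by linarith) hε
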